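/- Model. A heap construction with CompareArray is a comparison-based algorithm that, for every $m\ge 0$, takes an array of $m$ elements of a linear order, rearranges it, and fills a CompareArray which for every node of the resulting binary tree (the array read as a heap) contains "left", "right" or "unknown". It builds fine heaps if, on every input, the resulting array is a max-heap, an entry "left" or "right" occurs only at nodes with two children and names a child that is at least as large as its sibling, and no node with two children has the entry "unknown". Min-heaps are built by the same construction applied to the reversed order. The amortized cost of building one heap is the number of comparisons performed by the construction minus the number of comparisons stored in the CompareArray (entries different from "unknown") at its end. QuickHeapsort sorts an array of $n>1$ elements by choosing a pivot, partitioning the array into the elements $\geq$ pivot (left), the pivot, and the elements $\leq$ pivot (right), building a heap on the smaller of the two parts (a max-heap if it is the left part; a min-heap if it is the right part, which is taken when both have the same size), moving all elements of the heap to their final positions, and recursively sorting the elements of the other part. For a heap construction $C$, let $T_{\mathrm{con}}^{\mathrm{amort}}(n)$ be the supremum, over all arrays of $n$ elements of a linear order and all executions (all choices of pivots, all results of partitioning and all orders in which the remaining elements are passed to the recursive call), of the sum of the amortized costs of all heaps built during the execution. Proposition. There is a heap construction with CompareArray which builds fine heaps, uses at most $\frac{23}{12}m+\mathcal{O}(\lg^2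 m)$ comparisons on every array of size $m$ (where $\lg=\log_2$), and for which, on all inputs and in all executions, $$T_{\mathrm{con}}^{\mathrm{amort}}(n)\;\leq\;\frac{17}{12}\,n+o(n).$$ The constant in the $\mathcal{O}$-term and the function in the $o$-term depend neither on the input array and its linear order nor on the choices made in the execution. -/

import Mathlib

open Filter Asymptotics

universe u

/-- The two values `left`, `right` that the CompareArray can store at a node; the third value,
"unknown", is the `none` of `Option Side`. -/
inductive Side : Type
  | left
  | right

/-- A comparison algorithm on an array with `m` positions, as a decision tree: it either stops with
an output, or compares the elements that stand at the positions `i` and `j` of the input array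
(is `A i ≤ A j`?) and continues according to the answer. -/
inductive ComparisonTree (m : ℕ) (β : Type) : Type
  | result (out : β) : ComparisonTree m β
  | compare (i j : Fin m) (yes no : ComparisonTree m β) : ComparisonTree m β

namespace ComparisonTree

variable {α : Type u} [LinearOrder α] {m : ℕ} {β : Type}

/-- The output on the input array `A`. -/
def output (A : Fin m → α) : ComparisonTree m β → β
  | result out => out
  | compare i j yes no => if A i ≤ A j then output A yes else output A no

/-- The number of comparisons performed on the input array `A`. -/
def comparisons (A : Fin m → α) : ComparisonTree m β → ℕ
  | result _ => 0
  | compare i j yes no => 1 + if A i ≤ A j then comparisons A yes else comparisons A no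

end ComparisonTree

/-- What a heap construction leaves behind: the rearrangement of the array (the element at position
`i` of the new array is the one that was at position `perm i`) and the CompareArray. -/
structure HeapOutput (m : ℕ) : Type where
  perm : Equiv.Perm (Fin m)
  compareArray : Fin m → Option Side

/-- `H` is a max-heap. Positions are numbered from `0`, so the left and right children of `i` are
`2 * i + 1` and `2 * i + 2`, where these are positions of the array. -/
def IsMaxHeap {α : Type u} [LinearOrder α] {m : ℕ} (H : Fin m → α) : Prop :=
  ∀ i j : Fin m, (j : ℕ) = 2 * i + 1 ∨ (j : ℕ) = 2 * i + 2 → H j ≤ H i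

/-- Whatever the CompareArray `c` stores is a correct comparison of two siblings of `H`: an entry
stands only at a node with two children, and the child it names is not smaller than the other. -/
def IsCorrectCompareArray {α : Type u} [LinearOrder α] {m : ℕ} (H : Fin m → α)
    (c : Fin m → Option Side) : Prop :=
  ∀ i : Fin m, ∀ s : Side, c i = some s →
    ∃ l r : Fin m, (l : ℕ) = 2 * i + 1 ∧ (r : ℕ) = 2 * i + 2 ∧
      match s with
      | Side.left => H r ≤ H l
      | Side.right => H l ≤ H r

/-- A fine (max-)heap: a max-heap with a correct CompareArray in which, for every node with two
children, the larger child is stored. -/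
structure IsFineHeap {α : Type u} [LinearOrder α] {m : ℕ} (H : Fin m → α)
    (c : Fin m → Option Side) : Prop where
  heap : IsMaxHeap H
  correct : IsCorrectCompareArray H c
  full : ∀ i : Fin m, 2 * (i : ℕ) + 2 < m → c i ≠ none

/-- A heap construction with CompareArray: for every size `m` a comparison algorithm. -/
def HeapConstruction : Type := (m : ℕ) → ComparisonTree m (HeapOutput m)

namespace HeapConstruction

variable (C : HeapConstruction) {α : Type u} [LinearOrder α] {m : ℕ}

/-- The array after the construction. -/
def heap (A : Fin m → α) : Fin m → α := fun i => A (((C m).output A).perm i)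

/-- The CompareArray after the construction. -/
def compareArray (A : Fin m → α) : Fin m → Option Side := ((C m).output A).compareArray

/-- The number of comparisons that the construction performs. -/
def comparisons (A : Fin m → α) : ℕ := (C m).comparisons A

/-- The number of comparisons stored in the CompareArray after the construction. -/
def stored (A : Fin m → α) : ℕ :=
  (Finset.univ.filter fun i : Fin m => (C.compareArray A i).isSome = true).card

/-- The amortized cost of the construction of one heap: comparisons performed minus comparisons
stored in the CompareArray. -/
def amortizedCost (A : Fin m → α) : ℤ := (C.comparisons A : ℤ) - (C.stored A : ℤ)

end HeapConstruction

section Run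

variable {α : Type u}

/-- The part of the array `P` to the left of position `k`. -/
def leftPart {n : ℕ} (P : Fin n → α) (k : Fin n) : Fin (k : ℕ) → α :=
  fun i => P ⟨i, i.2.trans k.2⟩

/-- The part of the array `P` to the right of position `k`. -/
def rightPart {n : ℕ} (P : Fin n → α) (k : Fin n) : Fin (n - 1 - (k : ℕ)) → α :=
  fun i => P ⟨(k : ℕ) + 1 + i, by have := i.2; omega⟩

/-- `B` is a rearrangement of the array `A`. -/
def IsRearrangement {n : ℕ} (A B : Fin n → α) : Prop :=
  ∃ π : Equiv.Perm (Fin n), ∀ i, B i = A (π i)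

variable [LinearOrder α]

/-- `P` is partitioned (in reverse) around the pivot at position `k`. -/
def IsPartitioned {n : ℕ} (P : Fin n → α) (k : Fin n) : Prop :=
  (∀ i, i < k → P k ≤ P i) ∧ (∀ i, k < i → P i ≤ P k)

/-- `QuickHeapsortRun C A c`: there is an execution of QuickHeapsort on the array `A` with the heap
construction `C` in which the amortized costs of all heap constructions sum up to `c`.

Arrays with at most one element are left alone. Otherwise the array is partitioned around an
arbitrary pivot `P k` (any choice of the pivot and any result `P` of partitioning is allowed). The
smaller part is the heap-area: a max-heap is built if it is the left part, and otherwise a min-heap,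
that is, a max-heap for the reversed order. The extraction phase moves all elements of the heap to
their final places; what remains to be sorted recursively are the elements of the larger part, the
work-area, in whatever order `B` they have been left (every order is allowed). -/
inductive QuickHeapsortRun (C : HeapConstruction) : {n : ℕ} → (Fin n → α) → ℤ → Prop
  | done {n : ℕ} (A : Fin n → α) (hn : n ≤ 1) : QuickHeapsortRun C A 0
  | maxHeap {n : ℕ} (A P : Fin n → α) (k : Fin n) (B : Fin (n - 1 - (k : ℕ)) → α) (c : ℤ)
      (hn : 1 < n) (hAP : IsRearrangement A P) (hP : IsPartitioned P k)
      (hk : (k : ℕ) < n - 1 - (k : ℕ))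
      (hB : IsRearrangement (rightPart P k) B) (hrec : QuickHeapsortRun C B c) :
      QuickHeapsortRun C A (C.amortizedCost (leftPart P k) + c)
  | minHeap {n : ℕ} (A P : Fin n → α) (k : Fin n) (B : Fin (k : ℕ) → α) (c : ℤ)
      (hn : 1 < n) (hAP : IsRearrangement A P) (hP : IsPartitioned P k)
      (hk : n - 1 - (k : ℕ) ≤ (k : ℕ))
      (hB : IsRearrangement (leftPart P k) B) (hrec : QuickHeapsortRun C B c) :
      QuickHeapsortRun C A
        (C.amortizedCost (fun i => OrderDual.toDual (rightPart P k i)) + c)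

end Run

/-- The amortized cost of heap construction during a whole run of QuickHeapsort, in the worst case
over all arrays of `n` elements of `α` and all executions (a supremum in the extended reals). -/
noncomputable def TconAmort (C : HeapConstruction) (α : Type u) [LinearOrder α] (n : ℕ) : EReal :=
  ⨆ (A : Fin n → α) (c : ℤ) (_ : QuickHeapsortRun C A c), ((c : ℝ) : EReal)

/-! The construction builds perfect seven-element fine heaps in batches and puts the remaining nodes
on top of them one at a time.

Putting a new label on top of two fine heaps uses the path of larger children, searched from the
bottom up. Each level of the path is charged at most once: either the new label is compared with the
label there, or a label has moved up and the sibling comparison is redone. This gives height plus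
two comparisons, and all entries of the CompareArray stay correct (`spec_merge`).

Seven elements treated separately cost 10 comparisons. Ten elements yield a seven-element heap and a
triple with 12 comparisons, and two such triples with one further element form another seven-element
heap with 4 more. So 21 elements give three heaps with 28 comparisons (`spec_sevens`).

In units of 1/12 comparison, a perfect heap of height `k ≥ 3` costs at most `23 * 2 ^ k - 12 * (k +
3)` (`buildCost_full`). In a left-complete tree that is not perfect, the gain of the perfect
subtrees along the boundary path pays for the merges, so the bound `23 * (m + 1)` is never exceeded
(`LeftComplete.buildCost_le`). No logarithmic error remains, and both error terms of the theorem can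
be zero.

A fine heap stores an entry at each of its roughly `m / 2` nodes with two children, which lowers
23/12 to 17/12, with an additive constant of at most 17/12 (`amortizedCost_le`). The pivot, which
lies in neither part, absorbs this constant, and induction over the run sums the costs
(`le_of_quickHeapsortRun`). -/

/-! ### Decision trees and reasoning about output and cost together. -/

namespace ComparisonTree

variable {m : ℕ} {β γ : Type}

/-- Run `p`, then the algorithm that `f` selects from the output of `p`. -/
def bind : ComparisonTree m β → (β → ComparisonTree m γ) → ComparisonTree m γ
  | result b, f => f b
  | compare i j yes no, f => compare i j (yes.bind f) (no.bind f)

variable {α : Type u} [LinearOrder α]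

/-- On the input `A`, the output of `p` and the number of its comparisons satisfy `Q`. -/
def Spec (A : Fin m → α) (p : ComparisonTree m β) (Q : β → ℕ → Prop) : Prop :=
  Q (p.output A) (p.comparisons A)

variable {A : Fin m → α}

theorem Spec.mono {p : ComparisonTree m β} {Q R : β → ℕ → Prop} (h : Spec A p Q)
    (hQR : ∀ b k, Q b k → R b k) : Spec A p R :=
  hQR _ _ h

theorem spec_result {b : β} {Q : β → ℕ → Prop} (h : Q b 0) : Spec A (result b) Q := h

theorem output_bind (p : ComparisonTree m β) (f : β → ComparisonTree m γ) :
    (p.bind f).output A = (f (p.output A)).output A := by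
  induction p with
  | result b => rfl
  | compare i j yes no hy hn =>
    simp only [bind, output]
    split_ifs
    · exact hy
    · exact hn

theorem comparisons_bind (p : ComparisonTree m β) (f : β → ComparisonTree m γ) :
    (p.bind f).comparisons A = p.comparisons A + (f (p.output A)).comparisons A := by
  induction p with
  | result b => simp [bind, output, comparisons]
  | compare i j yes no hy hn =>
    simp only [bind, output, comparisons]
    split_ifs
    · rw [hy, add_assoc]
    · rw [hn, add_assoc]

/-- The sequencing rule: costs add, so every later analysis follows the program text. -/
theorem Spec.bind {p : ComparisonTree m β} {f : β → ComparisonTree m γ} {R : β → ℕ → Prop}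
    {Q : γ → ℕ → Prop} (hp : Spec A p R)
    (hf : ∀ b k, R b k → Spec A (f b) fun c l => Q c (k + l)) : Spec A (p.bind f) Q := by
  have := hf _ _ hp
  unfold Spec at this ⊢
  rwa [output_bind, comparisons_bind]

theorem spec_compare {i j : Fin m} {yes no : ComparisonTree m β} {Q : β → ℕ → Prop}
    (hy : A i ≤ A j → Spec A yes fun b k => Q b (k + 1))
    (hn : A j ≤ A i → Spec A no fun b k => Q b (k + 1)) : Spec A (compare i j yes no) Q := by
  unfold Spec at *
  simp only [output, comparisons]
  split_ifs with h
  · rw [add_comm]; exact hy h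
  · rw [add_comm]; exact hn (le_of_not_ge h)

/-- Sort two elements, the larger one first. -/
def sortPair (i j : Fin m) : ComparisonTree m (Fin m × Fin m) :=
  compare i j (result (j, i)) (result (i, j))

theorem spec_sortPair (i j : Fin m) :
    Spec A (sortPair i j) fun b k => A b.2 ≤ A b.1 ∧
      ({b.1} + {b.2} : Multiset (Fin m)) = {i} + {j} ∧ k = 1 :=
  spec_compare (fun h => spec_result ⟨h, add_comm _ _, rfl⟩) fun h => spec_result ⟨h, rfl, rfl⟩

end ComparisonTree

/-! ### Tree shapes and labelled fine heaps. -/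

/-- The shape of a binary tree. -/
inductive Shape : Type
  | nil
  | node (l r : Shape) : Shape

namespace Shape

def size : Shape → ℕ
  | nil => 0
  | node l r => l.size + r.size + 1

def height : Shape → ℕ
  | nil => 0
  | node l r => max l.height r.height + 1

/-- The shape of a perfect binary tree. -/
def full : ℕ → Shape
  | 0 => nil
  | k + 1 => node (full k) (full k)

end Shape

/-- Binary trees in which every node carries a label and an entry of the CompareArray. -/
inductive HeapTree (ι : Type) : Type
  | nil : HeapTree ι
  | node (x : ι) (s : Option Side) (l r : HeapTree ι) : HeapTree ι

namespace HeapTree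

variable {ι : Type}

def root : HeapTree ι → Option ι
  | nil => none
  | node x _ _ _ => some x

def entry : HeapTree ι → Option Side
  | nil => none
  | node _ s _ _ => s

def left : HeapTree ι → HeapTree ι
  | nil => nil
  | node _ _ l _ => l

def right : HeapTree ι → HeapTree ι
  | nil => nil
  | node _ _ _ r => r

def shape : HeapTree ι → Shape
  | nil => .nil
  | node _ _ l r => .node l.shape r.shape

def labels : HeapTree ι → Multiset ι
  | nil => 0
  | node x _ l r => {x} + (l.labels + r.labels)

/-- The tree with a single node. -/
def leaf (x : ι) : HeapTree ι := node x none nil nil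

/-- The tree with root `a` and the children `b` (the larger one) and `c`. -/
def triple (a b c : ι) : HeapTree ι := node a (some .left) (leaf b) (leaf c)

theorem shape_eq_nil {t : HeapTree ι} : t.shape = .nil ↔ t = nil := by
  cases t <;> simp [shape]

theorem card_labels (t : HeapTree ι) : Multiset.card t.labels = t.shape.size := by
  induction t with
  | nil => rfl
  | node x s l r hl hr => simp [labels, shape, Shape.size, hl, hr]

variable {α : Type u} [LinearOrder α]

/-- `s` is the correct entry for a node with subtrees `l` and `r`. -/
def IsEntry (A : ι → α) (s : Option Side) (l r : HeapTree ι) : Prop :=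
  match s with
  | none => r = nil
  | some .left => ∃ y z, l.root = some y ∧ r.root = some z ∧ A z ≤ A y
  | some .right => ∃ y z, l.root = some y ∧ r.root = some z ∧ A y ≤ A z

/-- All labels are sorted as in a fine heap. -/
def Fine (A : ι → α) : HeapTree ι → Prop
  | nil => True
  | node x s l r => (∀ y ∈ l.root, A y ≤ A x) ∧ (∀ y ∈ r.root, A y ≤ A x) ∧ IsEntry A s l r ∧
      l.Fine A ∧ r.Fine A

theorem fine_triple {A : ι → α} {a b c : ι} (hab : A b ≤ A a) (hbc : A c ≤ A b) :
    (triple a b c).Fine A := by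
  simp [triple, leaf, Fine, IsEntry, root, hab, hbc, hbc.trans hab]

end HeapTree

open ComparisonTree HeapTree

/-! ### Merging two fine heaps under a new label. -/

section Merge

variable {m : ℕ} {α : Type u} [LinearOrder α] {A : Fin m → α}

/-- The entry for a node with subtrees `l` and `r`, found with at most one comparison. -/
def findEntry : HeapTree (Fin m) → HeapTree (Fin m) → ComparisonTree m (Option Side)
  | .node y _ _ _, .node z _ _ _ => compare y z (result (some .right)) (result (some .left))
  | _, _ => result none

/-- The number of comparisons of `findEntry`, in terms of the shape of the right subtree. -/
def entryCost : Shape → ℕ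
  | .nil => 0
  | .node _ _ => 1

theorem spec_findEntry {l r : HeapTree (Fin m)} (h : l = .nil → r = .nil) :
    Spec A (findEntry l r) fun s k => IsEntry A s l r ∧ k ≤ entryCost r.shape := by
  cases l with
  | nil => cases h rfl; exact spec_result ⟨rfl, le_rfl⟩
  | node y s l₁ l₂ =>
    cases r with
    | nil => exact spec_result ⟨rfl, le_rfl⟩
    | node z s' r₁ r₂ =>
      exact spec_compare (fun h => spec_result ⟨⟨y, z, rfl, rfl, h⟩, le_rfl⟩)
        fun h => spec_result ⟨⟨y, z, rfl, rfl, h⟩, le_rfl⟩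

/-- The node with label the root of `c`, and subtrees `l` and `r`. -/
def promote (c l r : HeapTree (Fin m)) : ComparisonTree m (Option (HeapTree (Fin m))) :=
  match c with
  | .nil => result none
  | .node z _ _ _ => (findEntry l r).bind fun s => result (some (.node z s l r))

/-- Insert a label below a node with entry `s` and subtrees `l` and `r`, where `pl` and `pr` try to
insert it into the subtrees; if this succeeds, the root of the larger subtree moves up. -/
def insertBelow (s : Option Side) (l r : HeapTree (Fin m))
    (pl pr : ComparisonTree m (Option (HeapTree (Fin m)))) :
    ComparisonTree m (Option (HeapTree (Fin m))) :=
  match s with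
  | some .right => pr.bind fun
    | none => result none
    | some r' => promote r l r'
  | _ => pl.bind fun
    | none => result none
    | some l' => promote l l' r

/-- Try to insert `x` on the path of larger children of `t`, from the bottom to the top; if this
succeeds, all labels above `x` move up and the root of `t` is removed. The output is `none` if `x`
is larger than the root. -/
def sift (x : Fin m) : HeapTree (Fin m) → ComparisonTree m (Option (HeapTree (Fin m)))
  | .nil => result none
  | .node y s l r => (insertBelow s l r (sift x l) (sift x r)).bind fun
    | some t => result (some t)
    | none => compare x y (result (some (.node x s l r))) (result none)

/-- What `sift x t` achieves. -/
def SiftResult (A : Fin m → α) (x : Fin m) (t : HeapTree (Fin m)) :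
    Option (HeapTree (Fin m)) → Prop
  | none => ∀ y ∈ t.root, A y ≤ A x
  | some t' => ∃ y, t.root = some y ∧ A x ≤ A y ∧ (∀ z ∈ t'.root, A z ≤ A y) ∧
      t'.shape = t.shape ∧ t'.Fine A ∧ {y} + t'.labels = {x} + t.labels

/-- What `insertBelow` achieves. -/
def InsertResult (A : Fin m → α) (x : Fin m) (l r : HeapTree (Fin m)) :
    Option (HeapTree (Fin m)) → ℕ → Prop
  | none, k => (∀ y ∈ l.root, A y ≤ A x) ∧ (∀ y ∈ r.root, A y ≤ A x) ∧
      k ≤ max l.shape.height r.shape.height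
  | some t', k => ∃ y, t'.root = some y ∧ (l.root = some y ∨ r.root = some y) ∧ A x ≤ A y ∧
      t'.shape = .node l.shape r.shape ∧ t'.Fine A ∧ t'.labels = {x} + (l.labels + r.labels) ∧
      k ≤ max l.shape.height r.shape.height + entryCost r.shape

theorem spec_promote {c l r : HeapTree (Fin m)} {y : Fin m} (hc : c.root = some y)
    (hlr : l = .nil → r = .nil) (hl : ∀ z ∈ l.root, A z ≤ A y) (hr : ∀ z ∈ r.root, A z ≤ A y)
    (hlf : l.Fine A) (hrf : r.Fine A) :
    Spec A (promote c l r) fun o k => ∃ t, o = some t ∧ t.root = some y ∧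
      t.shape = .node l.shape r.shape ∧ t.Fine A ∧ t.labels = {y} + (l.labels + r.labels) ∧
      k ≤ entryCost r.shape := by
  cases c with
  | nil => simp [root] at hc
  | node z s' l' r' =>
    obtain rfl : z = y := by simpa [root] using hc
    refine (spec_findEntry hlr).bind fun s k ⟨hs, hk⟩ => spec_result ?_
    exact ⟨_, rfl, rfl, rfl, ⟨hl, hr, hs, hlf, hrf⟩, rfl, hk⟩

/-- The stored entry selects the larger child, so failure there shows that the new label dominates
both children. Only success changes a subtree root, and only then is the entry recomputed, at cost
`entryCost`. -/
theorem spec_insertBelow {x : Fin m} {s : Option Side} {l r : HeapTree (Fin m)}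
    {pl pr : ComparisonTree m (Option (HeapTree (Fin m)))} (hs : IsEntry A s l r)
    (hl : l.Fine A) (hr : r.Fine A)
    (hpl : Spec A pl fun o k => SiftResult A x l o ∧ k ≤ l.shape.height)
    (hpr : Spec A pr fun o k => SiftResult A x r o ∧ k ≤ r.shape.height) :
    Spec A (insertBelow s l r pl pr) (InsertResult A x l r) := by
  have hleft : (∀ y ∈ l.root, ∀ z ∈ r.root, A z ≤ A y) → (l = .nil → r = .nil) →
      Spec A (pl.bind fun
        | none => result none
        | some l' => promote l l' r) (InsertResult A x l r) := by
    intro hlr hnil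
    refine hpl.bind fun o k ⟨ho, hk⟩ => ?_
    cases o with
    | none =>
      refine spec_result ⟨ho, ?_, hk.trans (le_max_left _ _)⟩
      intro z hz
      cases hlroot : l.root with
      | none =>
        have : l = .nil := by cases l <;> simp_all [root]
        simp [hnil this, root] at hz
      | some y => exact (hlr y hlroot z hz).trans (ho y hlroot)
    | some l' =>
      obtain ⟨y, hy, hxy, hl', hsh, hf, hlab⟩ := ho
      have hnil' : l' = .nil → r = .nil := fun h => by
        subst h
        exact hnil (shape_eq_nil.1 hsh.symm)
      refine (spec_promote hy hnil' hl' (hlr y hy) hf hr).mono ?_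
      rintro o' k' ⟨t, rfl, ht, hts, htf, htl, hk'⟩
      refine ⟨y, ht, .inl hy, hxy, by rw [hts, hsh], htf, ?_, ?_⟩
      · rw [htl, ← add_assoc, hlab, add_assoc]
      · have := le_max_left l.shape.height r.shape.height
        omega
  rcases s with _ | _ | _
  · have hrn : r = .nil := hs
    subst hrn
    exact hleft (by simp [root]) fun _ => rfl
  · obtain ⟨y, z, hy, hz, hzy⟩ := hs
    refine hleft ?_ ?_
    · intro y' hy' z' hz'
      rw [hy] at hy'; rw [hz] at hz'
      cases hy'; cases hz'
      exact hzy
    · rintro rfl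
      simp [root] at hy
  · obtain ⟨y, z, hy, hz, hyz⟩ := hs
    refine hpr.bind fun o k ⟨ho, hk⟩ => ?_
    cases o with
    | none =>
      refine spec_result ⟨fun w hw => ?_, ho, hk.trans (le_max_right _ _)⟩
      rw [hy] at hw; cases hw
      exact hyz.trans (ho z hz)
    | some r' =>
      obtain ⟨z', hz', hxy, hr', hsh, hf, hlab⟩ := ho
      obtain rfl : z = z' := by simpa [hz] using hz'
      have hly : ∀ w ∈ l.root, A w ≤ A z := fun w hw => by
        rw [hy] at hw; cases hw
        exact hyz
      refine (spec_promote hz ?_ hly hr' hl hf).mono ?_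
      · rintro rfl
        simp [root] at hy
      rintro o' k' ⟨t, rfl, ht, hts, htf, htl, hk'⟩
      refine ⟨z, ht, .inr hz, hxy, by rw [hts, hsh], htf, ?_, ?_⟩
      · rw [htl, add_left_comm, hlab, add_left_comm]
      · rw [hsh] at hk'
        have := le_max_right l.shape.height r.shape.height
        omega

theorem entryCost_le_one (s : Shape) : entryCost s ≤ 1 := by
  cases s <;> simp [entryCost]

/-- One comparison per level suffices: after success below, the level pays at most for renewing its
entry; after failure below, it pays for comparing `x` with its label, and the entry remains valid.
-/
theorem spec_sift (x : Fin m) {t : HeapTree (Fin m)} (ht : t.Fine A) :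
    Spec A (sift x t) fun o k => SiftResult A x t o ∧ k ≤ t.shape.height := by
  induction t with
  | nil => exact spec_result ⟨by simp [SiftResult, root], le_rfl⟩
  | node y s l r hl hr =>
    obtain ⟨hly, hry, hs, hlf, hrf⟩ := ht
    refine (spec_insertBelow hs hlf hrf (hl hlf) (hr hrf)).bind fun o k ho => ?_
    cases o with
    | some t' =>
      obtain ⟨z, hz, hz', hxz, hsh, hf, hlab, hk⟩ := ho
      have hzy : A z ≤ A y := hz'.elim (hly z) (hry z)
      refine spec_result ⟨⟨y, rfl, hxz.trans hzy, ?_, hsh, hf, ?_⟩, ?_⟩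
      · intro w hw
        rw [hz] at hw; cases hw
        exact hzy
      · rw [hlab, labels, add_left_comm]
      · have := entryCost_le_one r.shape
        simp only [shape, Shape.height]
        omega
    | none =>
      obtain ⟨hxl, hxr, hk⟩ := ho
      refine spec_compare (fun h => spec_result ⟨⟨y, rfl, h, ?_, rfl, ?_, ?_⟩, ?_⟩)
        fun h => spec_result ⟨?_, ?_⟩
      · rintro w ⟨⟩
        exact h
      · exact ⟨hxl, hxr, hs, hlf, hrf⟩
      · simp only [labels, add_left_comm]
      · simp only [shape, Shape.height]; omega
      · rintro w ⟨⟩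
        exact h
      · simp only [shape, Shape.height]; omega

/-- Combine the trees `l` and `r` and the new label `x` into one tree. -/
def merge (x : Fin m) (l r : HeapTree (Fin m)) : ComparisonTree m (HeapTree (Fin m)) :=
  (findEntry l r).bind fun s => (insertBelow s l r (sift x l) (sift x r)).bind fun
    | some t => result t
    | none => result (.node x s l r)

/-- An upper bound for the number of comparisons of `merge`. -/
def mergeCost (l r : Shape) : ℕ := max l.height r.height + 2 * entryCost r

theorem spec_merge (x : Fin m) {l r : HeapTree (Fin m)} (hlr : l = .nil → r = .nil)
    (hl : l.Fine A) (hr : r.Fine A) :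
    Spec A (merge x l r) fun t k => t.shape = .node l.shape r.shape ∧ t.Fine A ∧
      t.labels = {x} + (l.labels + r.labels) ∧ k ≤ mergeCost l.shape r.shape := by
  refine (spec_findEntry hlr).bind fun s k ⟨hs, hk⟩ => ?_
  refine (spec_insertBelow hs hl hr (spec_sift x hl) (spec_sift x hr)).bind fun o k' ho => ?_
  cases o with
  | some t' =>
    obtain ⟨z, hz, hz', hxz, hsh, hf, hlab, hk'⟩ := ho
    exact spec_result ⟨hsh, hf, hlab, by unfold mergeCost; omega⟩
  | none =>
    obtain ⟨hxl, hxr, hk'⟩ := ho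
    exact spec_result ⟨rfl, ⟨hxl, hxr, hs, hl, hr⟩, rfl, by unfold mergeCost; omega⟩

end Merge

/-! ### Seven-element heaps in batches of three. -/

section Batch

variable {m : ℕ} {α : Type u} [LinearOrder α] {A : Fin m → α}

/-- `t` is a fine heap with seven elements. -/
def IsSeven (A : Fin m → α) (t : HeapTree (Fin m)) : Prop := t.shape = .full 3 ∧ t.Fine A

/-- Build the binomial tree with root `p.1`, the leaf `p.2.1` below it, and the chain
`p.1 ≥ p.2.2.1 ≥ p.2.2.2`. -/
def binomial (a b c d : Fin m) : ComparisonTree m (Fin m × Fin m × Fin m × Fin m) :=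
  (sortPair a b).bind fun p => (sortPair c d).bind fun q =>
    compare p.1 q.1 (result (q.1, q.2, p.1, p.2)) (result (p.1, p.2, q.1, q.2))

theorem spec_binomial (a b c d : Fin m) :
    Spec A (binomial a b c d) fun p k => A p.2.1 ≤ A p.1 ∧ A p.2.2.1 ≤ A p.1 ∧
      A p.2.2.2 ≤ A p.2.2.1 ∧
      ({p.1} + {p.2.1} + ({p.2.2.1} + {p.2.2.2}) : Multiset (Fin m)) = {a} + {b} + ({c} + {d}) ∧
      k = 3 := by
  refine (spec_sortPair a b).bind fun p k ⟨hp, hpl, hk⟩ => ?_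
  refine (spec_sortPair c d).bind fun q k' ⟨hq, hql, hk'⟩ => ?_
  subst hk hk'
  refine spec_compare (fun h => spec_result ⟨hq, h, hp, ?_, rfl⟩)
    fun h => spec_result ⟨hp, h, hq, ?_, rfl⟩
  · rw [hpl, hql, add_comm]
  · rw [hpl, hql]

/-- Build a fine heap from seven elements with `a ≥ b`, `c ≥ d` and `r ≥ a, c`, with at most five
comparisons. -/
def sevenOfChains (r a b c d x y : Fin m) : ComparisonTree m (HeapTree (Fin m)) :=
  compare x a
    ((sortPair b x).bind fun p => compare y c
      ((sortPair d y).bind fun q => compare c a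
        (result (.node r (some .left) (triple a p.1 p.2) (triple c q.1 q.2)))
        (result (.node r (some .left) (triple c q.1 q.2) (triple a p.1 p.2))))
      (compare y a
        (result (.node r (some .left) (triple a p.1 p.2) (triple y c d)))
        ((sortPair r y).bind fun q =>
          result (.node q.1 (some .left) (triple q.2 c d) (triple a p.1 p.2)))))
    (merge y (triple x a b) (triple r c d))

theorem isSeven_node_triple {r a b c x y z : Fin m} (hra : A a ≤ A r) (hab : A b ≤ A a)
    (hbc : A c ≤ A b) (hax : A x ≤ A a) (hxy : A y ≤ A x) (hyz : A z ≤ A y) :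
    IsSeven A (.node r (some .left) (triple a b c) (triple x y z)) := by
  refine ⟨rfl, ?_, ?_, ⟨a, x, rfl, rfl, hax⟩, fine_triple hab hbc, fine_triple hxy hyz⟩
  · rintro w ⟨⟩
    exact hra
  · rintro w ⟨⟩
    exact hax.trans hra

/-- `sortPair` records its output only as a multiset; this lemma and the next transfer bounds on
both inputs to the sorted pair. -/
theorem fst_le_of_pair_eq {p q b x : Fin m} {v : α}
    (h : ({p} + {q} : Multiset (Fin m)) = {b} + {x}) (hb : A b ≤ v) (hx : A x ≤ v) : A p ≤ v := by
  have : p ∈ ({b} + {x} : Multiset (Fin m)) := by rw [← h]; simp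
  rcases Multiset.mem_add.1 this with h | h <;> rw [Multiset.mem_singleton.1 h] <;> assumption

theorem le_snd_of_pair_eq {p q b x : Fin m} {v : α}
    (h : ({p} + {q} : Multiset (Fin m)) = {b} + {x})
    (hb : v ≤ A b) (hx : v ≤ A x) : v ≤ A q := by
  have : q ∈ ({b} + {x} : Multiset (Fin m)) := by rw [← h]; simp
  rcases Multiset.mem_add.1 this with h | h <;> rw [Multiset.mem_singleton.1 h] <;> assumption

theorem labels_triple {a b c : Fin m} : (triple a b c).labels = {a} + ({b} + {c}) := by
  simp [triple, leaf, labels]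

/-- If `x` is below `a`, it joins `b` as a child of `a`, and the rest is a case analysis on `y`. If
`x` is above `a`, then `x, a, b` and `r, c, d` are already fine triples, so merging them under `y`
takes only four more comparisons. -/
theorem spec_sevenOfChains {r a b c d x y : Fin m} (hra : A a ≤ A r) (hab : A b ≤ A a)
    (hrc : A c ≤ A r) (hcd : A d ≤ A c) :
    Spec A (sevenOfChains r a b c d x y) fun t k => IsSeven A t ∧
      t.labels = {r} + ({a} + {b}) + ({c} + {d}) + ({x} + {y}) ∧ k ≤ 5 := by
  refine spec_compare (fun hxa => ?_) fun hax => ?_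
  · refine (spec_sortPair b x).bind fun p k ⟨hp, hpl, hk⟩ => ?_
    subst hk
    have hap : A p.1 ≤ A a := fst_le_of_pair_eq hpl hab hxa
    refine spec_compare (fun hyc => ?_) fun hcy => ?_
    · refine (spec_sortPair d y).bind fun q k ⟨hq, hql, hk⟩ => ?_
      subst hk
      have hcq : A q.1 ≤ A c := fst_le_of_pair_eq hql hcd hyc
      have hlab : ({r} + (({a} + ({p.1} + {p.2})) + ({c} + ({q.1} + {q.2}))) : Multiset (Fin m)) =
          {r} + ({a} + {b}) + ({c} + {d}) + ({x} + {y}) := by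
        rw [hpl, hql]
        abel
      refine spec_compare (fun hca => spec_result ⟨?_, ?_, le_rfl⟩)
        fun hac => spec_result ⟨?_, ?_, le_rfl⟩
      · exact isSeven_node_triple hra hap hp hca hcq hq
      · rw [labels, labels_triple, labels_triple, hlab]
      · exact isSeven_node_triple hrc hcq hq hac hap hp
      · rw [labels, labels_triple, labels_triple, ← hlab]
        abel
    · refine spec_compare (fun hya => spec_result ⟨?_, ?_, by norm_num⟩) fun hay => ?_
      · exact isSeven_node_triple hra hap hp hya hcy hcd
      · rw [labels, labels_triple, labels_triple, hpl]
        abel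
      -- Here `r` and `y` both dominate `a` and `c`, so the smaller of them can be the parent of `c`
      -- and `d` and is also the larger child of the root.
      · refine (spec_sortPair r y).bind fun q k ⟨hq, hql, hk⟩ => ?_
        subst hk
        refine spec_result ⟨?_, ?_, le_rfl⟩
        · exact isSeven_node_triple hq (le_snd_of_pair_eq hql hrc hcy) hcd
            (le_snd_of_pair_eq hql hra hay) hap hp
        · rw [labels, labels_triple, labels_triple, hpl]
          calc _ = ({q.1} + {q.2}) + ({c} + {d} + ({a} + ({b} + {x}))) := by abel
            _ = _ := by rw [hql]; abel
  · refine (spec_merge y (fun h => by simp [triple] at h) (fine_triple hax hab)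
      (fine_triple hrc hcd)).mono fun t k ⟨hsh, hf, hl, hk⟩ => ⟨⟨hsh, hf⟩, ?_, ?_⟩
    · rw [hl, labels_triple, labels_triple]
      abel
    · exact Nat.succ_le_succ hk

/-- Build from ten elements a fine heap with seven elements and one with three elements. -/
def sevenAndTriple (a b c d a' b' c' d' x y : Fin m) :
    ComparisonTree m (HeapTree (Fin m) × HeapTree (Fin m)) :=
  (binomial a b c d).bind fun p => (binomial a' b' c' d').bind fun q =>
    compare q.2.1 p.2.1
      ((sevenOfChains p.1 p.2.1 q.2.1 p.2.2.1 p.2.2.2 x y).bind fun t =>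
        result (t, triple q.1 q.2.2.1 q.2.2.2))
      ((sevenOfChains q.1 q.2.1 p.2.1 q.2.2.1 q.2.2.2 x y).bind fun t =>
        result (t, triple p.1 p.2.2.1 p.2.2.2))

/-- Comparing the leaves of two binomial trees lets one tree take over the leaf of the other as the
end of a chain. The tree that loses its leaf is a chain of three, which is already a fine triple.
The count is `3 + 3 + 1 + 5`. -/
theorem spec_sevenAndTriple (a b c d a' b' c' d' x y : Fin m) :
    Spec A (sevenAndTriple a b c d a' b' c' d' x y) fun t k => IsSeven A t.1 ∧
      t.2.shape = .full 2 ∧ t.2.Fine A ∧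
      t.1.labels + t.2.labels =
        ({a} + {b} + ({c} + {d})) + ({a'} + {b'} + ({c'} + {d'})) + ({x} + {y}) ∧ k ≤ 12 := by
  refine (spec_binomial a b c d).bind fun p k ⟨hp₁, hp₂, hp₃, hpl, hk⟩ => ?_
  refine (spec_binomial a' b' c' d').bind fun q k' ⟨hq₁, hq₂, hq₃, hql, hk'⟩ => ?_
  subst hk hk'
  rw [← hpl, ← hql]
  refine spec_compare (fun h => ?_) fun h => ?_
  · refine (spec_sevenOfChains hp₁ h hp₂ hp₃).bind fun t k ⟨ht, hl, hk⟩ => ?_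
    refine spec_result ⟨ht, rfl, fine_triple hq₂ hq₃, ?_, by omega⟩
    rw [hl, labels_triple]
    abel
  · refine (spec_sevenOfChains hq₁ h hq₂ hq₃).bind fun t k ⟨ht, hl, hk⟩ => ?_
    refine spec_result ⟨ht, rfl, fine_triple hp₂ hp₃, ?_, by omega⟩
    rw [hl, labels_triple]
    abel

/-- Build a fine heap from seven elements. -/
def seven (a b c d e f g : Fin m) : ComparisonTree m (HeapTree (Fin m)) :=
  (merge a (leaf b) (leaf c)).bind fun l => (merge d (leaf e) (leaf f)).bind fun r => merge g l r

theorem fine_leaf (x : Fin m) : (leaf x).Fine A := by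
  simp [leaf, Fine, IsEntry, root]

theorem spec_merge_leaf (a b c : Fin m) :
    Spec A (merge a (leaf b) (leaf c)) fun t k => t.shape = .full 2 ∧ t.Fine A ∧
      t.labels = {a} + ({b} + {c}) ∧ k ≤ 3 :=
  (spec_merge a (fun h => by simp [leaf] at h) (fine_leaf b) (fine_leaf c)).mono
    fun t k ⟨hsh, hf, hl, hk⟩ => ⟨hsh, hf, by rw [hl]; simp [leaf, labels], hk⟩

theorem spec_merge_full {x : Fin m} {l r : HeapTree (Fin m)} (hl : l.shape = .full 2)
    (hr : r.shape = .full 2) (hlf : l.Fine A) (hrf : r.Fine A) :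
    Spec A (merge x l r) fun t k => IsSeven A t ∧ t.labels = {x} + (l.labels + r.labels) ∧
      k ≤ 4 := by
  refine (spec_merge x (fun h => ?_) hlf hrf).mono fun t k ⟨hsh, hf, hlab, hk⟩ =>
    ⟨⟨?_, hf⟩, hlab, ?_⟩
  · subst h
    simp [shape, Shape.full] at hl
  · rw [hsh, hl, hr]
    rfl
  · rw [hl, hr] at hk
    exact hk

theorem spec_seven (a b c d e f g : Fin m) :
    Spec A (seven a b c d e f g) fun t k => IsSeven A t ∧
      t.labels = {g} + (({a} + ({b} + {c})) + ({d} + ({e} + {f}))) ∧ k ≤ 10 := by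
  refine (spec_merge_leaf a b c).bind fun l k ⟨hl, hlf, hll, hk⟩ => ?_
  refine (spec_merge_leaf d e f).bind fun r k' ⟨hr, hrf, hrl, hk'⟩ => ?_
  refine (spec_merge_full hl hr hlf hrf).mono fun t k'' ⟨ht, htl, hk''⟩ => ⟨ht, ?_, by omega⟩
  rw [htl, hll, hrl]

/-- Take ten elements from a list, and build from them a fine heap with seven elements and one with
three elements. -/
def takeSevenAndTriple : List (Fin m) →
    ComparisonTree m (HeapTree (Fin m) × HeapTree (Fin m) × List (Fin m))
  | a :: b :: c :: d :: a' :: b' :: c' :: d' :: x :: y :: xs =>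
    (sevenAndTriple a b c d a' b' c' d' x y).bind fun t => result (t.1, t.2, xs)
  | xs => result (.nil, .nil, xs)

theorem spec_takeSevenAndTriple {xs : List (Fin m)} (h : 10 ≤ xs.length) :
    Spec A (takeSevenAndTriple xs) fun t k => IsSeven A t.1 ∧ t.2.1.shape = .full 2 ∧
      t.2.1.Fine A ∧ t.1.labels + t.2.1.labels + (t.2.2 : Multiset (Fin m)) = xs ∧
      t.2.2.length + 10 = xs.length ∧ k ≤ 12 := by
  match xs, h with
  | a :: b :: c :: d :: a' :: b' :: c' :: d' :: x :: y :: xs, _ =>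
    refine (spec_sevenAndTriple a b c d a' b' c' d' x y).bind fun t k ⟨h₁, h₂, h₃, h₄, hk⟩ => ?_
    refine spec_result ⟨h₁, h₂, h₃, ?_, rfl, hk⟩
    rw [h₄]
    simp only [← Multiset.cons_coe, ← Multiset.singleton_add]
    abel

/-- Take seven elements from a list, and build a fine heap from them. -/
def takeSeven : List (Fin m) → ComparisonTree m (HeapTree (Fin m) × List (Fin m))
  | a :: b :: c :: d :: e :: f :: g :: xs =>
    (seven a b c d e f g).bind fun t => result (t, xs)
  | xs => result (.nil, xs)

theorem spec_takeSeven {xs : List (Fin m)} (h : 7 ≤ xs.length) :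
    Spec A (takeSeven xs) fun t k => IsSeven A t.1 ∧
      t.1.labels + (t.2 : Multiset (Fin m)) = xs ∧ t.2.length + 7 = xs.length ∧ k ≤ 10 := by
  match xs, h with
  | a :: b :: c :: d :: e :: f :: g :: xs, _ =>
    refine (spec_seven a b c d e f g).bind fun t k ⟨h₁, h₂, hk⟩ => ?_
    refine spec_result ⟨h₁, ?_, rfl, hk⟩
    rw [h₂]
    simp only [← Multiset.cons_coe, ← Multiset.singleton_add]
    abel

/-- The labels of all trees in a list. -/
def forestLabels (ts : List (HeapTree (Fin m))) : Multiset (Fin m) := (ts.map labels).sum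

theorem forestLabels_cons (t : HeapTree (Fin m)) (ts : List (HeapTree (Fin m))) :
    forestLabels (t :: ts) = t.labels + forestLabels ts := by
  simp [forestLabels]

/-- Take `7 * q` elements from a list, and build `q` fine heaps with seven elements from them; three
of these heaps are built together with `28` comparisons. -/
def sevens : ℕ → List (Fin m) → ComparisonTree m (List (HeapTree (Fin m)) × List (Fin m))
  | q + 3, xs => (takeSevenAndTriple xs).bind fun t => (takeSevenAndTriple t.2.2).bind fun t' =>
      match t'.2.2 with
      | [] => result ([], [])
      | x :: ys => (merge x t.2.1 t'.2.1).bind fun t'' => (sevens q ys).bind fun p =>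
          result (t.1 :: t'.1 :: t'' :: p.1, p.2)
  | 0, xs => result ([], xs)
  | q + 1, xs => (takeSeven xs).bind fun t => (sevens q t.2).bind fun p =>
      result (t.1 :: p.1, p.2)

theorem spec_sevens (q : ℕ) : ∀ {xs : List (Fin m)}, 7 * q ≤ xs.length →
    Spec A (sevens q xs) fun p k => p.1.length = q ∧ (∀ t ∈ p.1, IsSeven A t) ∧
      forestLabels p.1 + (p.2 : Multiset (Fin m)) = xs ∧ p.2.length + 7 * q = xs.length ∧
      3 * k ≤ 28 * q + 2 * (q % 3) := by
  -- The one or two heaps left after the batches cost 10 each, which exceeds `28 / 3` by `2 / 3`;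
  -- this is the term `2 * (q % 3)`. With `q < 2`, the remainder increases by one without wrapping
  -- around.
  have step : ∀ q, q < 2 → (∀ {xs : List (Fin m)}, 7 * q ≤ xs.length →
      Spec A (sevens q xs) fun p k => p.1.length = q ∧ (∀ t ∈ p.1, IsSeven A t) ∧
        forestLabels p.1 + (p.2 : Multiset (Fin m)) = xs ∧ p.2.length + 7 * q = xs.length ∧
        3 * k ≤ 28 * q + 2 * (q % 3)) →
      ∀ {xs : List (Fin m)}, 7 * (q + 1) ≤ xs.length →
      Spec A ((takeSeven xs).bind fun t => (sevens q t.2).bind fun p =>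
          result (t.1 :: p.1, p.2)) fun p k => p.1.length = q + 1 ∧ (∀ t ∈ p.1, IsSeven A t) ∧
        forestLabels p.1 + (p.2 : Multiset (Fin m)) = xs ∧
        p.2.length + 7 * (q + 1) = xs.length ∧ 3 * k ≤ 28 * (q + 1) + 2 * ((q + 1) % 3) := by
    intro q hq ih xs hxs
    refine (spec_takeSeven (by omega)).bind fun t k ⟨ht, htl, hlen, hk⟩ => ?_
    refine (ih (xs := t.2) (by omega)).bind fun p k' ⟨hp, hps, hpl, hplen, hk'⟩ => ?_
    refine spec_result ⟨by simp [hp], ?_, ?_, by dsimp only; omega, by omega⟩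
    · simpa using ⟨ht, hps⟩
    · rw [forestLabels_cons, add_assoc, hpl, htl]
  induction q using Nat.strong_induction_on with
  | _ q ih =>
    intro xs hxs
    match q with
    | 0 => exact spec_result ⟨rfl, by simp, by simp [forestLabels], by simp, by simp⟩
    | 1 => exact step 0 (by norm_num) (ih 0 (by norm_num)) hxs
    | 2 => exact step 1 (by norm_num) (ih 1 (by norm_num)) hxs
    | q + 3 =>
      rw [sevens]
      refine (spec_takeSevenAndTriple (by omega)).bind fun t k ⟨h₁, h₂, h₃, h₄, h₅, hk⟩ => ?_
      refine (spec_takeSevenAndTriple (by omega)).bind fun t' k' ⟨h₁', h₂', h₃', h₄', h₅', hk'⟩ => ?_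
      obtain ⟨T, C, ys⟩ := t'
      cases ys with
      | nil => simp at h₅'; omega
      | cons x ys =>
        simp only [List.length_cons] at h₁' h₂' h₃' h₄' h₅' ⊢
        refine (spec_merge_full h₂ h₂' h₃ h₃').bind fun t'' k'' ⟨ht, htl, hk''⟩ => ?_
        refine (ih q (by omega) (xs := ys) (by omega)).bind
          fun p l ⟨hp, hps, hpl, hplen, hl⟩ => ?_
        refine spec_result ⟨by simp [hp], ?_, ?_, by dsimp only; omega, by omega⟩
        · simpa using ⟨h₁, h₁', ht, hps⟩
        · simp only [forestLabels_cons]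
          rw [← h₄, ← h₄', ← Multiset.cons_coe, ← hpl, htl, ← Multiset.singleton_add]
          abel

end Batch

/-! ### Counting seven-element subtrees and the cost above them. -/

namespace Shape

open Classical in
/-- The number of maximal subtrees that are perfect of height three. -/
noncomputable def sevenCount : Shape → ℕ
  | nil => 0
  | node l r => if node l r = full 3 then 1 else l.sevenCount + r.sevenCount

open Classical in
/-- The number of nodes outside of the perfect subtrees of height three. -/
noncomputable def singleCount : Shape → ℕ
  | nil => 0
  | node l r => if node l r = full 3 then 0 else l.singleCount + r.singleCount + 1

open Classical in
/-- The cost of building a heap if the perfect subtrees of height three are given. -/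
noncomputable def buildCost : Shape → ℕ
  | nil => 0
  | node l r => if node l r = full 3 then 0 else l.buildCost + r.buildCost + mergeCost l r

/-- Nodes with a right child have a left child. -/
def LeftFirst : Shape → Prop
  | nil => True
  | node l r => (l = nil → r = nil) ∧ l.LeftFirst ∧ r.LeftFirst

theorem size_full (k : ℕ) : (full k).size + 1 = 2 ^ k := by
  induction k with
  | zero => rfl
  | succ k ih => simp only [full, size, pow_succ]; omega

theorem height_full (k : ℕ) : (full k).height = k := by
  induction k with
  | zero => rfl
  | succ k ih => simp [full, height, ih]

theorem singleCount_add (s : Shape) : s.singleCount + 7 * s.sevenCount = s.size := by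
  induction s with
  | nil => rfl
  | node l r hl hr =>
    simp only [singleCount, sevenCount]
    split_ifs with h
    · rw [h]; rfl
    · simp only [size]; omega

end Shape

/-! ### Assembling a heap of a prescribed shape. -/

section Build

variable {m : ℕ} {α : Type u} [LinearOrder α] {A : Fin m → α}

open Classical in
/-- Build a heap of the given shape from a list of labels and a list of heaps with seven elements. -/
noncomputable def build : Shape → List (Fin m) → List (HeapTree (Fin m)) →
    ComparisonTree m (HeapTree (Fin m) × List (Fin m) × List (HeapTree (Fin m)))
  | .nil, xs, ts => result (.nil, xs, ts)
  | .node l r, xs, ts =>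
    if Shape.node l r = .full 3 then
      match ts with
      | [] => result (.nil, xs, [])
      | t :: ts => result (t, xs, ts)
    else
      match xs with
      | [] => result (.nil, [], ts)
      | x :: xs => (build l xs ts).bind fun p => (build r p.2.1 p.2.2).bind fun q =>
          (merge x p.1 q.1).bind fun t => result (t, q.2)

theorem spec_build {s : Shape} (hs : s.LeftFirst) : ∀ {xs : List (Fin m)}
    {ts : List (HeapTree (Fin m))}, s.singleCount ≤ xs.length → s.sevenCount ≤ ts.length →
    (∀ t ∈ ts, IsSeven A t) →
    Spec A (build s xs ts) fun p k => p.1.shape = s ∧ p.1.Fine A ∧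
      p.2.1.length + s.singleCount = xs.length ∧ p.2.2.length + s.sevenCount = ts.length ∧
      (∀ t ∈ p.2.2, IsSeven A t) ∧
      p.1.labels + ((p.2.1 : Multiset (Fin m)) + forestLabels p.2.2) = xs + forestLabels ts ∧
      k ≤ s.buildCost := by
  induction s with
  | nil =>
    intro xs ts _ _ hts
    exact spec_result ⟨rfl, trivial, rfl, rfl, hts, zero_add _, le_rfl⟩
  | node l r ihl ihr =>
    intro xs ts hxs hts hA
    obtain ⟨hlr, hl, hr⟩ := hs
    rw [build.eq_def]
    simp only [Shape.singleCount, Shape.sevenCount, Shape.buildCost] at hxs hts ⊢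
    split_ifs at hxs hts ⊢ with h
    · cases ts with
      | nil => simp at hts
      | cons t ts =>
        have ht := hA t (by simp)
        refine spec_result ⟨ht.1.trans h.symm, ht.2, rfl, rfl,
          fun t' ht' => hA t' (by simp [ht']), ?_, le_rfl⟩
        rw [forestLabels_cons]
        abel
    · cases xs with
      | nil => simp at hxs
      | cons x xs =>
        rw [List.length_cons] at hxs
        refine (ihl hl (xs := xs) (ts := ts) (by omega) (by omega) hA).bind
          fun p k ⟨h₁, h₂, h₃, h₄, h₅, h₆, hk⟩ => ?_
        refine (ihr hr (xs := p.2.1) (ts := p.2.2) (by omega) (by omega) h₅).bind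
          fun q k' ⟨h₁', h₂', h₃', h₄', h₅', h₆', hk'⟩ => ?_
        have hnil : p.1 = .nil → q.1 = .nil := by
          rw [← shape_eq_nil, ← shape_eq_nil, h₁, h₁']
          exact hlr
        refine (spec_merge x hnil h₂ h₂').bind fun t k'' ⟨hsh, hf, hlab, hk''⟩ => ?_
        rw [h₁, h₁'] at hsh hk''
        refine spec_result ⟨hsh, hf, ?_, ?_, h₅', ?_, ?_⟩
        · simp only [List.length_cons]; omega
        · dsimp only; omega
        · rw [hlab, ← Multiset.cons_coe, ← Multiset.singleton_add,
            add_assoc {x} (xs : Multiset (Fin m)), ← h₆, add_assoc, add_assoc, h₆']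
        · omega

end Build

/-! ### Cost bounds for perfect and left-complete shapes. -/

namespace Shape

/-- The shapes of left-complete trees that are not perfect, by their height. -/
inductive LeftComplete : ℕ → Shape → Prop
  | full_full (k : ℕ) : LeftComplete (k + 2) (node (full (k + 1)) (full k))
  | left {k : ℕ} {l : Shape} (hl : LeftComplete (k + 1) l) :
      LeftComplete (k + 2) (node l (full k))
  | right {k : ℕ} {r : Shape} (hr : LeftComplete (k + 1) r) :
      LeftComplete (k + 2) (node (full (k + 1)) r)

theorem LeftComplete.height_eq {k : ℕ} {s : Shape} (h : LeftComplete k s) : s.height = k := by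
  induction h with
  | full_full k => simp [height, height_full]
  | left _ ih => simp [height, height_full, ih]
  | right _ ih => simp [height, height_full, ih]

theorem LeftComplete.size_lt {k : ℕ} {s : Shape} (h : LeftComplete k s) : s.size + 1 < 2 ^ k := by
  induction h with
  | full_full k =>
    have h₁ := size_full k
    have h₂ := size_full (k + 1)
    have h₃ := Nat.two_pow_pos k
    simp only [size, pow_succ] at *
    omega
  | left _ ih =>
    rename_i k _ _
    have h₁ := size_full k
    have h₃ := Nat.two_pow_pos k
    simp only [size, pow_succ] at *
    omega
  | right _ ih =>
    rename_i k _ _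
    have h₁ := size_full (k + 1)
    simp only [size, pow_succ] at *
    omega

theorem LeftComplete.ne_full {k : ℕ} {s : Shape} (h : LeftComplete k s) (j : ℕ) :
    s ≠ full j := by
  rintro rfl
  have h₁ := h.height_eq
  rw [height_full] at h₁
  subst h₁
  have := h.size_lt
  have := size_full j
  omega

theorem LeftComplete.two_le {k : ℕ} {s : Shape} (h : LeftComplete k s) : 2 ≤ k := by
  cases h <;> omega

theorem full_succ_ne_nil (k : ℕ) : full (k + 1) ≠ nil := by
  simp [full]

theorem leftFirst_full (k : ℕ) : (full k).LeftFirst := by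
  induction k with
  | zero => trivial
  | succ k ih => exact ⟨id, ih, ih⟩

theorem LeftComplete.leftFirst {k : ℕ} {s : Shape} (h : LeftComplete k s) : s.LeftFirst := by
  induction h with
  | full_full k =>
    exact ⟨fun h => absurd h (full_succ_ne_nil k), leftFirst_full _, leftFirst_full _⟩
  | left hl ih =>
    refine ⟨fun h => ?_, ih, leftFirst_full _⟩
    exact absurd h (hl.ne_full 0)
  | right hr ih => exact ⟨fun h => absurd h (full_succ_ne_nil _), leftFirst_full _, ih⟩

/-- The amount, multiplied by `12`, by which the cost of a perfect heap of height `k` stays below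
`23 / 12 * 2 ^ k`, if a heap with seven elements costs `28 / 3`. -/
def fullGain : ℕ → ℕ
  | 0 => 23
  | 1 => 46
  | 2 => 56
  | k + 3 => 12 * (k + 6)

theorem full_eq_full {j k : ℕ} (h : full j = full k) : j = k := by
  rw [← height_full j, h, height_full]

/-- The weight 112 is `12 * 28 / 3`. From height three on, the gain `12 * (k + 3)` solves the
recurrence exactly: twice it minus the merge cost `12 * (k + 2)` is `12 * (k + 4)`. -/
theorem buildCost_full (k : ℕ) : 12 * (full k).buildCost + 112 * (full k).sevenCount +
    fullGain k ≤ 23 * 2 ^ k := by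
  induction k with
  | zero => simp [full, buildCost, sevenCount, fullGain]
  | succ k ih =>
    have hne : node (full k) (full k) = full 3 ↔ k = 2 :=
      ⟨fun h => by simpa using full_eq_full (j := k + 1) h, fun h => by rw [h]; rfl⟩
    rw [full]
    simp only [buildCost, sevenCount, hne]
    match k, ih with
    | 0, _ => simp [full, buildCost, sevenCount, fullGain, mergeCost, height, entryCost]
    | 1, ih =>
      simp only [fullGain, mergeCost, height_full] at *
      have : entryCost (full 1) = 1 := rfl
      simp
      omega
    | 2, _ => simp [fullGain]
    | k + 3, ih =>
      have : entryCost (full (k + 3)) = 1 := rfl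
      simp only [fullGain, mergeCost, height_full, pow_succ] at *
      simp
      omega

/-- The analogue of `fullGain` for left-complete heaps that are not perfect. -/
def leftCompleteGain : ℕ → ℕ
  | 0 | 1 | 2 => 57
  | 3 => 54
  | _ => 50

theorem mergeCost_le (l r : Shape) : mergeCost l r ≤ max l.height r.height + 2 := by
  have := entryCost_le_one r
  unfold mergeCost
  omega

/-- The gains of the children add, and the merge is subtracted. In the tight case, a child of height
`k` beside a perfect sibling of height `k - 1 ≥ 3`, the sibling's gain `12 * (k + 2)` equals the
merge cost, so the gain of the imperfect child is passed on undiminished. The small heights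
determine the constants 57, 54 and 50. -/
theorem LeftComplete.buildCost_le {k : ℕ} {s : Shape} (h : LeftComplete k s) :
    12 * s.buildCost + 112 * s.sevenCount + leftCompleteGain k ≤ 23 * (s.size + 1) := by
  induction h with
  | full_full k =>
    have hne := (LeftComplete.full_full k).ne_full 3
    have h₁ := buildCost_full k
    have h₂ := buildCost_full (k + 1)
    have h₃ := size_full k
    have h₄ := size_full (k + 1)
    have h₅ := mergeCost_le (full (k + 1)) (full k)
    rw [height_full, height_full] at h₅
    simp only [buildCost, sevenCount, if_neg hne, size]
    match k with
    | 0 => simp [full, buildCost, sevenCount, leftCompleteGain, mergeCost, height, entryCost, size]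
    | 1 | 2 | k + 3 => simp only [fullGain, leftCompleteGain] at *; omega
  | @left k l hl ih =>
    have hne := hl.left.ne_full 3
    have h₁ := buildCost_full k
    have h₃ := size_full k
    have h₅ := mergeCost_le l (full k)
    rw [height_full, hl.height_eq] at h₅
    simp only [buildCost, sevenCount, if_neg hne, size]
    match k with
    | 0 => exact absurd hl.two_le (by norm_num)
    | 1 | 2 | k + 3 => simp only [fullGain, leftCompleteGain] at *; omega
  | @right k r hr ih =>
    have hne := hr.right.ne_full 3
    have h₁ := buildCost_full (k + 1)
    have h₃ := size_full (k + 1)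
    have h₅ := mergeCost_le (full (k + 1)) r
    rw [height_full, hr.height_eq] at h₅
    simp only [buildCost, sevenCount, if_neg hne, size]
    match k with
    | 0 => exact absurd hr.two_le (by norm_num)
    | 1 | 2 | k + 3 => simp only [fullGain, leftCompleteGain] at *; omega

/-! ### Heap positions and left-complete shapes. -/

/-- The shape of the subtree at position `i` of a heap with `m` positions, cut off at height `d`. -/
def atPosition (m : ℕ) : ℕ → ℕ → Shape
  | 0, _ => nil
  | d + 1, i => if i < m then node (atPosition m d (2 * i + 1)) (atPosition m d (2 * i + 2)) else nil

theorem atPosition_of_le {m i : ℕ} (d : ℕ) (h : m ≤ i) : atPosition m d i = nil := by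
  cases d with
  | zero => rfl
  | succ d => simp [atPosition, h]

/-- The descendants of `i` at depth `j` occupy the positions from `2 ^ j * (i + 1) - 1` to `2 ^ j *
(i + 2) - 2`. The hypotheses say that this level is entirely present and the next one entirely
absent. -/
theorem atPosition_eq_full {m : ℕ} : ∀ (j d i : ℕ), m ≤ i + d → 2 ^ j * (i + 2) ≤ m + 1 →
    m + 1 ≤ 2 ^ (j + 1) * (i + 1) → atPosition m d i = full (j + 1) := by
  intro j
  induction j with
  | zero =>
    intro d i hd h₁ h₂
    obtain ⟨d, rfl⟩ : ∃ d', d = d' + 1 := ⟨d - 1, by omega⟩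
    rw [atPosition, if_pos (by omega), atPosition_of_le _ (by omega), atPosition_of_le _ (by omega)]
    rfl
  | succ j ih =>
    intro d i hd h₁ h₂
    have hpos := Nat.two_pow_pos j
    have hi : i < m := by
      rw [pow_succ] at h₁
      nlinarith
    obtain ⟨d, rfl⟩ : ∃ d', d = d' + 1 := ⟨d - 1, by omega⟩
    rw [atPosition, if_pos hi, full]
    congr 1
    · refine ih d _ (by omega) ?_ ?_ <;> simp only [pow_succ] at h₁ h₂ ⊢ <;> nlinarith
    · refine ih d _ (by omega) ?_ ?_ <;> simp only [pow_succ] at h₁ h₂ ⊢ <;> nlinarith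

theorem atPosition_leftComplete {m : ℕ} : ∀ (j d i : ℕ), m ≤ i + d → 2 ^ j * (i + 1) < m + 1 →
    m + 1 < 2 ^ j * (i + 2) → LeftComplete (j + 1) (atPosition m d i) ∧
      (atPosition m d i).size + 1 + 2 ^ j * i = m + 1 := by
  intro j
  induction j with
  | zero => intro d i _ h₁ h₂; omega
  | succ j ih =>
    intro d i hd h₁ h₂
    have hpos := Nat.two_pow_pos j
    have hi : i < m := by
      rw [pow_succ] at h₁
      nlinarith
    obtain ⟨d, rfl⟩ : ∃ d', d = d' + 1 := ⟨d - 1, by omega⟩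
    rw [atPosition, if_pos hi]
    have hfull : m + 1 ≤ 2 ^ j * (2 * i + 3) → atPosition m d (2 * i + 2) = full j := by
      intro h
      cases j with
      | zero => exact atPosition_of_le _ (by omega)
      | succ j =>
        refine atPosition_eq_full j d _ (by omega) ?_ ?_
        · rw [pow_succ, pow_succ] at h₁
          nlinarith
        · convert h using 2
    have hsize₁ := size_full j
    have hsize₂ := size_full (j + 1)
    -- The bottom level ends inside the left subtree, exactly at its end, or inside the right
    -- subtree.
    rcases lt_trichotomy (m + 1) (2 ^ j * (2 * i + 3)) with h | h | h
    · obtain ⟨hl, hs⟩ := ih d (2 * i + 1) (by omega) (by rw [pow_succ] at h₁; nlinarith) h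
      rw [hfull h.le]
      refine ⟨hl.left, ?_⟩
      simp only [size, pow_succ] at *
      nlinarith
    · rw [hfull h.le, atPosition_eq_full j d (2 * i + 1) (by omega) (by rw [h])
        (by rw [pow_succ] at *; nlinarith)]
      refine ⟨.full_full j, ?_⟩
      simp only [size, pow_succ] at *
      nlinarith
    · obtain ⟨hr, hs⟩ := ih d (2 * i + 2) (by omega) h (by rw [pow_succ] at h₂; nlinarith)
      rw [atPosition_eq_full j d (2 * i + 1) (by omega) h.le (by rw [pow_succ] at *; nlinarith)]
      refine ⟨hr.right, ?_⟩
      simp only [size, pow_succ] at *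
      nlinarith

/-- The shape of a heap with `m` positions. -/
def heap (m : ℕ) : Shape := atPosition m m 0

theorem heap_spec {m : ℕ} (hm : 1 ≤ m) : (heap m).LeftFirst ∧ (heap m).size = m ∧
    12 * (heap m).buildCost + 112 * (heap m).sevenCount + 46 ≤ 23 * (m + 1) := by
  have h₁ := Nat.pow_log_le_self 2 (x := m) (by omega)
  have h₂ := Nat.lt_pow_succ_log_self (b := 2) one_lt_two m
  set j := Nat.log 2 m
  rcases (Nat.succ_le_of_lt h₂).lt_or_eq with h | h
  · obtain ⟨hc, hs⟩ := atPosition_leftComplete (m := m) j m 0 (by omega) (by omega)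
      (by rw [pow_succ] at h; omega)
    rw [mul_zero, add_zero] at hs
    refine ⟨hc.leftFirst, Nat.succ_injective hs, ?_⟩
    have hcost := hc.buildCost_le
    rw [hs] at hcost
    -- 46 is the least gain over all nonempty heaps; a single node attains it in `fullGain`.
    have : 46 ≤ leftCompleteGain (j + 1) := by
      rcases j with _ | _ | _ | j <;> simp [leftCompleteGain]
    exact le_trans (Nat.add_le_add_left this _) hcost
  · have hf : heap m = full (j + 1) := atPosition_eq_full j m 0 (by omega)
      (by rw [pow_succ] at h; omega) (by omega)
    have hs := size_full (j + 1)
    rw [hf]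
    refine ⟨leftFirst_full _, by omega, ?_⟩
    have := buildCost_full (j + 1)
    rw [← h] at this
    have : 46 ≤ fullGain (j + 1) := by
      rcases j with _ | _ | j <;> simp [fullGain]
      omega
    omega

end Shape

/-! ### From trees back to arrays. -/

namespace HeapTree

variable {ι : Type}

/-- The subtree of `t` at position `i`. -/
def subtree (t : HeapTree ι) : ℕ → HeapTree ι
  | 0 => t
  | i + 1 => if i % 2 = 0 then (t.subtree (i / 2)).left else (t.subtree (i / 2)).right
termination_by i => i

theorem subtree_left (t : HeapTree ι) (i : ℕ) :
    t.subtree (2 * i + 1) = (t.subtree i).left := by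
  rw [subtree, if_pos (by omega), Nat.mul_div_cancel_left _ two_pos]

theorem subtree_right (t : HeapTree ι) (i : ℕ) :
    t.subtree (2 * i + 2) = (t.subtree i).right := by
  rw [subtree, if_neg (by omega)]
  congr 2
  omega

/-- A property of `t` that is inherited by children holds at all positions. -/
theorem subtree_induction {P : ℕ → HeapTree ι → Prop} {t : HeapTree ι} (h₀ : P 0 t)
    (hl : ∀ i s, P i s → P (2 * i + 1) s.left) (hr : ∀ i s, P i s → P (2 * i + 2) s.right)
    (i : ℕ) : P i (t.subtree i) := by
  induction i using Nat.strong_induction_on with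
  | _ i ih =>
    rcases Nat.eq_zero_or_pos i with rfl | hi
    · simpa [subtree] using h₀
    · rcases Nat.even_or_odd' i with ⟨k, rfl | rfl⟩
      · obtain ⟨k, rfl⟩ : ∃ k', k = k' + 1 := ⟨k - 1, by omega⟩
        rw [show 2 * (k + 1) = 2 * k + 2 by ring, subtree_right]
        exact hr k _ (ih k (by omega))
      · rw [subtree_left]
        exact hl k _ (ih k (by omega))

theorem exists_subtree_root {t : HeapTree ι} {x : ι} (hx : x ∈ t.labels) :
    ∃ i, (t.subtree i).root = some x := by
  suffices ∀ (s : HeapTree ι) (i : ℕ), t.subtree i = s → x ∈ s.labels →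
      ∃ i, (t.subtree i).root = some x from this t 0 (by simp [subtree]) hx
  intro s
  induction s with
  | nil => intro i _ h; simp [labels] at h
  | node y e l r hl hr =>
    intro i hi h
    rcases Multiset.mem_add.1 h with h | h
    · exact ⟨i, by rw [hi, Multiset.mem_singleton.1 h]; rfl⟩
    · rcases Multiset.mem_add.1 h with h | h
      · exact hl _ (by rw [subtree_left, hi]; rfl) h
      · exact hr _ (by rw [subtree_right, hi]; rfl) h

theorem fine_subtree {α : Type u} [LinearOrder α] {A : ι → α} {t : HeapTree ι} (ht : t.Fine A)
    (i : ℕ) : (t.subtree i).Fine A := by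
  refine subtree_induction (P := fun _ s => s.Fine A) ht ?_ ?_ i
  · rintro - (_ | _) h
    · exact h
    · exact h.2.2.2.1
  · rintro - (_ | _) h
    · exact h
    · exact h.2.2.2.2

theorem subtree_eq_nil_iff {m : ℕ} {t : HeapTree ι} (ht : t.shape = .heap m) (i : ℕ) :
    t.subtree i = nil ↔ m ≤ i := by
  have key : ∃ d, m ≤ i + d ∧ (t.subtree i).shape = Shape.atPosition m d i := by
    refine subtree_induction (P := fun i s => ∃ d, m ≤ i + d ∧ s.shape = Shape.atPosition m d i)
      ⟨m, by omega, ht⟩ ?_ ?_ i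
    all_goals
      rintro i s ⟨d, hd, hs⟩
      refine ⟨d - 1, by omega, ?_⟩
      rcases lt_or_ge i m with hi | hi
      · obtain ⟨d, rfl⟩ : ∃ d', d = d' + 1 := ⟨d - 1, by omega⟩
        rw [Shape.atPosition, if_pos hi] at hs
        cases s with
        | nil => simp [shape] at hs
        | node => simp only [shape, Shape.node.injEq] at hs; simp [left, right, hs]
      · rw [Shape.atPosition_of_le _ hi, shape_eq_nil] at hs
        rw [Shape.atPosition_of_le _ (by omega), hs]
        rfl
  obtain ⟨d, hd, hs⟩ := key
  rw [← shape_eq_nil, hs]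
  refine ⟨fun h => ?_, Shape.atPosition_of_le _⟩
  by_contra hi
  obtain ⟨d, rfl⟩ : ∃ d', d = d' + 1 := ⟨d - 1, by omega⟩
  simp [Shape.atPosition, not_le.1 hi] at h

/-- The label at position `i`. -/
def labelAt {m : ℕ} (t : HeapTree (Fin m)) (i : Fin m) : Fin m := (t.subtree i).root.getD i

theorem root_subtree {m : ℕ} {t : HeapTree (Fin m)} (ht : t.shape = .heap m) (i : Fin m) :
    (t.subtree i).root = some (t.labelAt i) := by
  have := mt (subtree_eq_nil_iff ht i).1 (not_le.2 i.2)
  unfold labelAt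
  cases h : t.subtree i with
  | nil => exact absurd h this
  | node => rfl

/-- Every label occurs at some position below `m`, and a surjection of a finite set onto itself is
bijective. Hence the default values in `labelAt` and `toOutput` are never used here. -/
theorem labelAt_bijective {m : ℕ} {t : HeapTree (Fin m)} (ht : t.shape = .heap m)
    (hl : ∀ x, x ∈ t.labels) : Function.Bijective t.labelAt := by
  rw [← Finite.surjective_iff_bijective]
  intro x
  obtain ⟨i, hi⟩ := exists_subtree_root (hl x)
  have him : i < m := by
    by_contra h
    rw [(subtree_eq_nil_iff ht i).2 (not_lt.1 h)] at hi
    simp [root] at hi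
  refine ⟨⟨i, him⟩, ?_⟩
  have := root_subtree ht ⟨i, him⟩
  rw [hi] at this
  exact (Option.some_injective _ this).symm

open Classical in
/-- The array and the CompareArray that represent a heap. -/
noncomputable def toOutput {m : ℕ} (t : HeapTree (Fin m)) : HeapOutput m where
  perm := if h : Function.Bijective t.labelAt then Equiv.ofBijective _ h else 1
  compareArray i := (t.subtree i).entry

theorem isFineHeap_toOutput {α : Type u} [LinearOrder α] {m : ℕ} {A : Fin m → α}
    {t : HeapTree (Fin m)} (ht : t.shape = .heap m) (hl : ∀ x, x ∈ t.labels) (hf : t.Fine A) :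
    IsFineHeap (fun i => A (t.toOutput.perm i)) t.toOutput.compareArray := by
  have hperm : ∀ i, t.toOutput.perm i = t.labelAt i := fun i => by
    simp only [toOutput, dif_pos (labelAt_bijective ht hl), Equiv.ofBijective_apply]
  have hroot : ∀ i : Fin m, (t.subtree i).root = some (t.toOutput.perm i) := fun i => by
    rw [hperm]
    exact root_subtree ht i
  have hnode : ∀ i : Fin m, ∃ l r, t.subtree i =
      .node (t.toOutput.perm i) (t.toOutput.compareArray i) l r ∧
      t.subtree (2 * i + 1) = l ∧ t.subtree (2 * i + 2) = r := fun i => by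
    have := hroot i
    rw [subtree_left, subtree_right]
    simp only [toOutput] at this ⊢
    cases h : t.subtree i with
    | nil => rw [h] at this; simp [root] at this
    | node x s l r =>
      rw [h] at this
      simp only [root, Option.some.injEq] at this
      exact ⟨l, r, by rw [← this]; rfl, rfl, rfl⟩
  have hpos : ∀ (k : ℕ) (y : Fin m), (t.subtree k).root = some y →
      ∃ j : Fin m, (j : ℕ) = k ∧ t.toOutput.perm j = y := fun k y hk => by
    have hkm : k < m := by
      by_contra h
      rw [(subtree_eq_nil_iff ht k).2 (not_lt.1 h)] at hk
      simp [root] at hk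
    exact ⟨⟨k, hkm⟩, rfl, Option.some_injective _ ((hroot ⟨k, hkm⟩).symm.trans hk)⟩
  refine ⟨fun i j hij => ?_, fun i s hs => ?_, fun i hi hnone => ?_⟩
  · obtain ⟨l, r, hi, hl, hr⟩ := hnode i
    have hfi := fine_subtree hf i
    rw [hi] at hfi
    have hj := hroot j
    rcases hij with hij | hij
    · rw [hij, hl] at hj
      exact hfi.1 _ hj
    · rw [hij, hr] at hj
      exact hfi.2.1 _ hj
  · obtain ⟨l, r, hi, hl, hr⟩ := hnode i
    have hfi := fine_subtree hf i
    rw [hi, hs] at hfi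
    have he := hfi.2.2.1
    cases s with
    | left =>
      obtain ⟨y, z, hy, hz, hyz⟩ := he
      obtain ⟨j, hj, rfl⟩ := hpos _ _ (hl ▸ hy)
      obtain ⟨k, hk, rfl⟩ := hpos _ _ (hr ▸ hz)
      exact ⟨j, k, hj, hk, hyz⟩
    | right =>
      obtain ⟨y, z, hy, hz, hyz⟩ := he
      obtain ⟨j, hj, rfl⟩ := hpos _ _ (hl ▸ hy)
      obtain ⟨k, hk, rfl⟩ := hpos _ _ (hr ▸ hz)
      exact ⟨j, k, hj, hk, hyz⟩
  · obtain ⟨l, r, hi', hl, hr⟩ := hnode i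
    have hfi := fine_subtree hf i
    rw [hi', hnone] at hfi
    have he : r = .nil := hfi.2.2.1
    rw [he, subtree_eq_nil_iff ht] at hr
    omega

end HeapTree

/-! ### The construction and its amortized cost. -/

section Construction

/-- A heap construction that builds fine heaps. -/
noncomputable def fineHeapConstruction : HeapConstruction := fun m =>
  (sevens (Shape.heap m).sevenCount (List.finRange m)).bind fun p =>
    (build (Shape.heap m) p.2 p.1).bind fun q => result q.1.toOutput

/-- The slack 46 from `Shape.heap_spec` pays for at most two unbatched heaps, each `8 / 12` of a
comparison over the average; this leaves 30. -/
theorem spec_fineHeapConstruction {α : Type u} [LinearOrder α] {m : ℕ} (A : Fin m → α) :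
    Spec A (fineHeapConstruction m) fun o k =>
      IsFineHeap (fun i => A (o.perm i)) o.compareArray ∧ (m = 0 → k = 0) ∧
        (1 ≤ m → 12 * k + 30 ≤ 23 * (m + 1)) := by
  have hspec : (Shape.heap m).LeftFirst ∧ (Shape.heap m).size = m ∧
      (1 ≤ m → 12 * (Shape.heap m).buildCost + 112 * (Shape.heap m).sevenCount + 46 ≤
        23 * (m + 1)) := by
    rcases Nat.eq_zero_or_pos m with rfl | hm
    · exact ⟨trivial, rfl, by simp⟩
    · obtain ⟨h₁, h₂, h₃⟩ := Shape.heap_spec hm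
      exact ⟨h₁, h₂, fun _ => h₃⟩
  obtain ⟨hfirst, hsize, hcost⟩ := hspec
  have hcount := (Shape.heap m).singleCount_add
  rw [hsize] at hcount
  have hlen : (List.finRange m).length = m := List.length_finRange
  refine (spec_sevens _ (by omega)).bind fun p k ⟨h₁, h₂, h₃, h₄, hk⟩ => ?_
  refine (spec_build hfirst (by omega) h₁.ge h₂).bind
    fun q k' ⟨hsh, hf, _, _, _, hlab, hk'⟩ => ?_
  refine spec_result ⟨isFineHeap_toOutput hsh ?_ hf, ?_, ?_⟩
  · rw [add_comm (p.2 : Multiset (Fin m)), h₃] at hlab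
    -- The labels form a submultiset of all positions and have the same cardinality, so nothing is
    -- left over.
    have hle : q.1.labels ≤ (List.finRange m : Multiset (Fin m)) := by
      rw [← hlab]
      exact Multiset.le_add_right _ _
    have heq := Multiset.eq_of_le_of_card_le hle (by
      rw [card_labels, hsh, hsize, Multiset.coe_card, hlen])
    intro x
    rw [heq]
    simp
  · rintro rfl
    have : (Shape.heap 0).buildCost = 0 := rfl
    omega
  · intro hm
    have := hcost hm
    omega

/-- The nodes with two children are exactly the positions below `(m - 1) / 2`, and fineness forces
an entry at each. -/
theorem le_stored {C : HeapConstruction} {α : Type u} [LinearOrder α] {m : ℕ} {A : Fin m → α}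
    (h : IsFineHeap (C.heap A) (C.compareArray A)) : m ≤ 2 * C.stored A + 2 := by
  have hcard : (m - 1) / 2 ≤ C.stored A := by
    unfold HeapConstruction.stored
    rw [← Finset.card_range ((m - 1) / 2)]
    refine Finset.card_le_card_of_surjOn (fun i : Fin m => (i : ℕ)) fun i hi => ?_
    have hi : i < (m - 1) / 2 := by simpa using hi
    refine ⟨⟨i, by omega⟩, ?_, rfl⟩
    have := h.full ⟨i, by omega⟩ (by dsimp only; omega)
    simpa [Option.isSome_iff_ne_none] using this
  omega

theorem amortizedCost_le {α : Type u} [LinearOrder α] {m : ℕ} (A : Fin m → α) :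
    12 * fineHeapConstruction.amortizedCost A ≤ 17 * (m + 1) := by
  obtain ⟨h₁, h₂, h₃⟩ := spec_fineHeapConstruction A
  have hst := le_stored (C := fineHeapConstruction) h₁
  have h₂ : m = 0 → fineHeapConstruction.comparisons A = 0 := h₂
  have h₃ : 1 ≤ m → 12 * fineHeapConstruction.comparisons A + 30 ≤ 23 * (m + 1) := h₃
  unfold HeapConstruction.amortizedCost
  omega

/-- The sizes of heap, pivot and work-area add up to `n`, so the `+ 1` in `amortizedCost_le` is
charged to the pivot. How the array splits plays no role. -/
theorem le_of_quickHeapsortRun {α : Type u} [LinearOrder α] {n : ℕ} {A : Fin n → α} {c : ℤ}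
    (h : QuickHeapsortRun fineHeapConstruction A c) : 12 * c ≤ 17 * n := by
  induction h with
  | done A hn => omega
  | maxHeap A P k B c hn hAP hP hk hB hrec ih =>
    have := amortizedCost_le (leftPart P k)
    omega
  | minHeap A P k B c hn hAP hP hk hB hrec ih =>
    have := amortizedCost_le fun i => OrderDual.toDual (rightPart P k i)
    omega

end Construction

theorem proposition2 :
    ∃ C : HeapConstruction,
      (∀ (α : Type u) [LinearOrder α] (m : ℕ) (A : Fin m → α),
        IsFineHeap (C.heap A) (C.compareArray A)) ∧
      (∃ K : ℝ, ∀ (α : Type u) [LinearOrder α] (m : ℕ) (A : Fin m → α),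
        (C.comparisons A : ℝ) ≤ 23 / 12 * (m : ℝ) + K * Real.logb 2 (m : ℝ) ^ 2) ∧
      ∃ r : ℕ → ℝ, r =o[atTop] (fun n : ℕ => (n : ℝ)) ∧
        ∀ (α : Type u) [LinearOrder α] (n : ℕ),
          TconAmort C α n ≤ ((17 / 12 * (n : ℝ) + r n : ℝ) : EReal) := by
  -- Zero serves both as the constant of the squared logarithm and as the lower-order function.
  refine ⟨fineHeapConstruction, fun α _ m A => (spec_fineHeapConstruction A).1,
    ⟨0, fun α _ m A => ?_⟩, fun _ => 0, isLittleO_zero _ _, fun α _ n => ?_⟩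
  · obtain ⟨-, h₂, h₃⟩ := spec_fineHeapConstruction A
    have h : 12 * fineHeapConstruction.comparisons A ≤ 23 * m := by
      have h₂ : m = 0 → fineHeapConstruction.comparisons A = 0 := h₂
      have h₃ : 1 ≤ m → 12 * fineHeapConstruction.comparisons A + 30 ≤ 23 * (m + 1) := h₃
      omega
    have h : (12 : ℝ) * fineHeapConstruction.comparisons A ≤ 23 * m := by exact_mod_cast h
    linarith
  · refine iSup_le fun A => iSup_le fun c => iSup_le fun hc => EReal.coe_le_coe_iff.2 ?_
    have h : (12 : ℝ) * c ≤ 17 * n := by exact_mod_cast le_of_quickHeapsortRun hc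
    linarith
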